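/- **Lagrange–Poisson top: the spin angle.** Consider a heavy rigid body with fixed point $O$, principal moments of inertia $A=B>0$ and $C>0$ at $O$, mass $M>0$, centre of mass on the symmetry axis at body coordinates $(0,0,z_G)$, $z_G>0$, in a gravity field $g>0$ directed along $-OZ$. Let $\theta,\varphi,\psi$ be the Euler angles (nutation, spin, precession) as differentiable functions of time $t\in\mathbb R$, and let $p,q,r$ be the body components of the angular velocity, $$p=\dot\theta\cos\varphi+\dot\psi\sin\theta\sin\varphi,\quad q=-\dot\theta\sin\varphi+\dot\psi\sin\theta\cos\varphi,\quad r=\dot\varphi+\dot\psi\cos\theta .$$ Assume that $p,q,r$ are differentiable and satisfy Euler's equations $$A\dot p=(A-C)qr+Mgz_G\gamma_2,\quad A\dot q=(C-A)rp-Mgz_G\gamma_1,\quad C\dot r=0,$$ where $(\gamma_1,\gamma_2,\gamma_3)=(\sin\theta\sin\varphi,\sin\theta\cos\varphi,\cos\theta)$ are the body components of the upward vertical. Let $r_0$, $K_{z,0}=Ap\gamma_1+Aq\gamma_2+Cr\gamma_3$ and $E_0=\frac12(Ap^2+Aq^2+Cr^2)+Mgz_G\gamma_3$ be the values at $t=0$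 of the axial angular velocity, the vertical angular momentum and the energy, and put $$\hat\rho=\sqrt{\tfrac{2Mgz_G}{A}},\quad h=\frac{E_0}{Mgz_G},\quad c=\frac CA,\quad \hat k=\frac{K_{z,0}}{A\hat\rho},\quad \lambda=\frac{r_0}{\hat\rho},$$ $$f(s)=\hat\rho^2\big[(h-c\lambda^2)-s\big](1-s^2)-\hat\rho^2\big[\hat k-c\lambda s\big]^2 .$$ Assume $c\lambda\neq\pm\hat k$ and $f(\cos\theta(0))>0$. Then: 1. $f(s)=\hat\rho^2(s-s_1)(s-s_2)(s-s_3)$ with real roots $-1<s_1<\cos\theta(0)<s_2<1<s_3$. Let $F_D^{(4)}$ be the Lauricella function, given by its power series when all four arguments have modulus $<1$ and by its Euler integral $\frac{\Gamma(c')}{\Gamma(a)\Gamma(c'-a)}\int_0^1u^{a-1}(1-u)^{c'-a-1}\prod_i(1-x_iu)^{-b_i}\,du$ otherwise, and let $$\Xi(y)=F_D^{(4)}\big(\tfrac12;1,1,\tfrac12,\tfrac12;\tfrac32\,\big|\,x(y)\big),\quad \Lambda(y)=F_D^{(4)}\big(\tfrac32;1,1,\tfrac12,\tfrac12;\tfrac52\,\big|\,x(y)\big),\quad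 \Omega(y)=F_D^{(4)}\big(\tfrac52;1,1,\tfrac12,\tfrac12;\tfrac72\,\big|\,x(y)\big),$$ $$x(y)=\Big(\tfrac{y-s_1}{1-s_1},\,-\tfrac{y-s_1}{1+s_1},\,-\tfrac{y-s_1}{s_1-s_3},\,-\tfrac{y-s_1}{s_1-s_2}\Big),\qquad N(y)=\frac{2\sqrt{y-s_1}}{(1-s_1^2)\sqrt{(s_3-s_1)(s_2-s_1)}} .$$ 2. For all $\alpha\in\mathbb R$ and $y\in[s_1,s_2]$ the integrand below is integrable and $$I_2:=\int_{s_1}^{y}\frac{1-\alpha u}{1-u^2}\,\frac{u\,du}{\sqrt{(s_3-u)(s_2-u)(u-s_1)}}=N(y)\Big[s_1(1-\alpha s_1)\,\Xi(y)+\tfrac{1-2\alpha s_1}{3}(y-s_1)\,\Lambda(y)-\tfrac{\alpha}{5}(y-s_1)^2\,\Omega(y)\Big].$$ 3. Let $t_0,t\in\mathbb R$ be such that $\cos\theta(t_0)=s_1$ and $\cos\theta\neq s_2$ at all times strictly between $t_0$ and $t$. Then, with $s=\cos\theta(t)$ and $\varepsilon=\operatorname{sign}(t-t_0)$ (that is,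 $\varepsilon=+1$ on the branch where $\cos\theta$ rises from $s_1$, $\varepsilon=-1$ on the branch where it falls to $s_1$, and $\varepsilon=0$ if $t=t_0$), $$\varphi(t)-\varphi(t_0)=\varepsilon\int_{s_1}^{s}\Big[\lambda-\frac{(\hat k-c\lambda u)u}{1-u^2}\Big]\frac{du}{\sqrt{(u-s_1)(u-s_2)(u-s_3)}}$$ and, in closed form, $$\varphi(t)-\varphi(t_0)=\varepsilon\,N(s)\Big[\big(\lambda(1-s_1^2)-(\hat k-c\lambda s_1)s_1\big)\,\Xi(s)-\tfrac{2\lambda s_1+\hat k-2c\lambda s_1}{3}(s-s_1)\,\Lambda(s)-\tfrac{\lambda-c\lambda}{5}(s-s_1)^2\,\Omega(s)\Big].$$ -/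

import Mathlib

open Real Set MeasureTheory

noncomputable section

/-- Defining series of the Lauricella function `F_D^{(n)}(a; b₁, …, bₙ; c | x₁, …, xₙ)`, a sum over
all multi-indices `m ∈ ℕⁿ`; it converges absolutely for `|x₁| < 1, …, |xₙ| < 1`. -/
def lauricellaSeries {n : ℕ} (a : ℝ) (b : Fin n → ℝ) (c : ℝ) (x : Fin n → ℝ) : ℝ :=
  ∑' m : Fin n → ℕ,
    (ascPochhammer ℝ (∑ i, m i)).eval a * (∏ i, (ascPochhammer ℝ (m i)).eval (b i)) /
        ((ascPochhammer ℝ (∑ i, m i)).eval c * ∏ i, ((m i).factorial : ℝ)) *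
      ∏ i, x i ^ m i

/-- Euler integral `Γ(c)/(Γ(a)Γ(c-a)) ∫₀¹ u^{a-1} (1-u)^{c-a-1} ∏ᵢ (1 - xᵢ u)^{-bᵢ} du`
(for `0 < a < c`). -/
def lauricellaIntegral {n : ℕ} (a : ℝ) (b : Fin n → ℝ) (c : ℝ) (x : Fin n → ℝ) : ℝ :=
  Gamma c / (Gamma a * Gamma (c - a)) *
    ∫ u in (0 : ℝ)..1, u ^ (a - 1) * (1 - u) ^ (c - a - 1) / ∏ i, (1 - x i * u) ^ b i

open Classical in
/-- The (real) Lauricella function `F_D^{(n)}`: the multiple power series on the polydisc `|xᵢ| < 1`,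
and outside of it the continuation of that series given by the Euler integral. -/
def lauricellaFD {n : ℕ} (a : ℝ) (b : Fin n → ℝ) (c : ℝ) (x : Fin n → ℝ) : ℝ :=
  if ∀ i, |x i| < 1 then lauricellaSeries a b c x else lauricellaIntegral a b c x

/-- The four arguments of the Lauricella functions, at `y = cos θ`. -/
def spinArgs (s₁ s₂ s₃ y : ℝ) : Fin 4 → ℝ :=
  ![(y - s₁) / (1 - s₁), -((y - s₁) / (1 + s₁)), -((y - s₁) / (s₁ - s₃)), -((y - s₁) / (s₁ - s₂))]

/-- `Ξ = F_D^{(4)}(1/2; 1, 1, 1/2, 1/2; 3/2 | …)`. -/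
def lauricellaXi (s₁ s₂ s₃ y : ℝ) : ℝ :=
  lauricellaFD (1 / 2) ![1, 1, 1 / 2, 1 / 2] (3 / 2) (spinArgs s₁ s₂ s₃ y)

/-- `Λ = F_D^{(4)}(3/2; 1, 1, 1/2, 1/2; 5/2 | …)`. -/
def lauricellaLambda (s₁ s₂ s₃ y : ℝ) : ℝ :=
  lauricellaFD (3 / 2) ![1, 1, 1 / 2, 1 / 2] (5 / 2) (spinArgs s₁ s₂ s₃ y)

/-- `Ω = F_D^{(4)}(5/2; 1, 1, 1/2, 1/2; 7/2 | …)`. -/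
def lauricellaOmega (s₁ s₂ s₃ y : ℝ) : ℝ :=
  lauricellaFD (5 / 2) ![1, 1, 1 / 2, 1 / 2] (7 / 2) (spinArgs s₁ s₂ s₃ y)

/-- Integrand of the integral `I₂(a, b, c; α; y)`. -/
def spinIntegrand (a b c α u : ℝ) : ℝ :=
  (1 - α * u) / (1 - u ^ 2) * (u / √((a - u) * (b - u) * (u - c)))

/-- `I₂(a, b, c; α; y) = ∫_c^y (1 - αu)/(1 - u²) · u/√((a-u)(b-u)(u-c)) du`. -/
def spinIntegral (a b c α y : ℝ) : ℝ :=
  ∫ u in c..y, spinIntegrand a b c α u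

/-- Motion of a heavy rigid body about a fixed point. `A, B, C` are the principal moments of inertia
at the fixed point, `(xG, yG, zG)` are the body coordinates of the centre of mass, `θ, φ, ψ` are the
Euler angles (nutation, spin, precession) as functions of time, and `p, q, r` are the body components
of the angular velocity. The upward vertical has body components
`γ₁ = sin θ sin φ`, `γ₂ = sin θ cos φ`, `γ₃ = cos θ`, and the torque is that of the weight
`-M g (γ₁, γ₂, γ₃)` applied at the centre of mass. -/
structure IsHeavyBodyMotion (A B C M g xG yG zG : ℝ) (θ φ ψ p q r : ℝ → ℝ) : Prop where
  differentiable_theta : Differentiable ℝ θ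
  differentiable_phi : Differentiable ℝ φ
  differentiable_psi : Differentiable ℝ ψ
  p_eq : ∀ t, p t = deriv θ t * cos (φ t) + deriv ψ t * sin (θ t) * sin (φ t)
  q_eq : ∀ t, q t = -deriv θ t * sin (φ t) + deriv ψ t * sin (θ t) * cos (φ t)
  r_eq : ∀ t, r t = deriv φ t + deriv ψ t * cos (θ t)
  differentiable_p : Differentiable ℝ p
  differentiable_q : Differentiable ℝ q
  differentiable_r : Differentiable ℝ r
  euler_p : ∀ t, A * deriv p t = (B - C) * q t * r t
    - M * g * (yG * cos (θ t) - zG * (sin (θ t) * cos (φ t)))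
  euler_q : ∀ t, B * deriv q t = (C - A) * r t * p t
    - M * g * (zG * (sin (θ t) * sin (φ t)) - xG * cos (θ t))
  euler_r : ∀ t, C * deriv r t = (A - B) * p t * q t
    - M * g * (xG * (sin (θ t) * cos (φ t)) - yG * (sin (θ t) * sin (φ t)))

/-- Resolvent cubic of the heavy gyroscope,
`f(s) = ρ² [(h - cλ²) - s] (1 - s²) - ρ² [k - cλs]²`. -/
def gyroResolvent (ρ h c k lam s : ℝ) : ℝ :=
  ρ ^ 2 * ((h - c * lam ^ 2) - s) * (1 - s ^ 2) - ρ ^ 2 * (k - c * lam * s) ^ 2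

end

/-! In the frame of the line of nodes the horizontal components of the angular velocity are θ' and
ψ' sin θ. Conservation of axial spin, vertical momentum and energy turns the motion of S = cos θ
into S'² = f(S), and φ' into a rational function of S; Euler's equations also give S'' = f'(S)/2
(`IsHeavyBodyMotion.exists_deriv_cos_theta`). Since f < 0 at ±1 and f > 0 at cos θ(0), the roots are
separated as claimed, and f(S) ≥ 0 confines S to [s₁, s₂].

At s₁ the acceleration is positive, so S rises strictly until it meets s₂, and dφ/dS can be
integrated along that branch; time reversal gives the falling branch (`sub_eq_sign_mul_integral`).

For the closed forms, both numerators are quadratics in u - s₁. The substitution u = s₁ + (y - s₁)v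
turns each power of u - s₁ into an Euler integral with c' = a + 1 (`integral_pow_div_sqrt_cubic`), a
case in which `lauricellaFD_eq_integral` treats series and integral alike. -/

/-! ### Lauricella series and Euler integrals -/

theorem hasSum_one_div_one_sub_rpow (b : ℝ) {x : ℝ} (hx : |x| < 1) :
    HasSum (fun m : ℕ => (ascPochhammer ℝ m).eval b / (m.factorial : ℝ) * x ^ m)
      (1 / (1 - x) ^ b) := by
  have h := (Real.one_div_one_sub_rpow_hasFPowerSeriesOnBall_zero b).hasSum (y := x)
    (by simpa [enorm_eq_nnnorm, ← NNReal.coe_lt_coe] using hx)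
  simp only [zero_add, FormalMultilinearSeries.ofScalars_apply_eq, smul_eq_mul] at h
  have hco (m : ℕ) : (ascPochhammer ℝ m).eval b / (m.factorial : ℝ) =
      Ring.choose (b + m - 1) m := by
    rw [← Ring.multichoose_eq, div_eq_iff (by positivity)]
    have := Ring.factorial_nsmul_multichoose_eq_ascPochhammer b m
    rw [Polynomial.ascPochhammer_smeval_eq_eval, nsmul_eq_mul] at this
    rw [← this, mul_comm]
  simpa only [hco] using h

theorem hasSum_mul_prod {ι κ : Type*} {f : ι → ℝ} {g : κ → ℝ} {s t : ℝ} (hf : HasSum f s)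
    (hg : HasSum g t) : HasSum (fun p : ι × κ => f p.1 * g p.2) (s * t) := by
  have hf' : Summable fun i => ‖f i‖ := hf.summable.norm
  have hg' : Summable fun i => ‖g i‖ := hg.summable.norm
  exact hf.mul hg (summable_mul_of_summable_norm hf' hg')

/-- Finite products of absolutely convergent real series. -/
theorem hasSum_prod_fin {n : ℕ} {f : Fin n → ℕ → ℝ} {s : Fin n → ℝ}
    (h : ∀ i, HasSum (f i) (s i)) :
    HasSum (fun m : Fin n → ℕ => ∏ i, f i (m i)) (∏ i, s i) := by
  induction n with
  | zero => simp
  | succ n ih =>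
    have h1 := ih (f := fun i => f i.succ) (s := fun i => s i.succ) fun i => h i.succ
    have h2 := hasSum_mul_prod (h 0) h1
    rw [Fin.prod_univ_succ, ← (Fin.consEquiv fun _ : Fin (n + 1) => ℕ).hasSum_iff]
    have h3 : (fun m : Fin (n + 1) → ℕ => ∏ i, f i (m i)) ∘ (Fin.consEquiv fun _ => ℕ) =
        fun p : ℕ × (Fin n → ℕ) => f 0 p.1 * ∏ i, f i.succ (p.2 i) := by
      funext p
      simp [Fin.prod_univ_succ, Fin.consEquiv]
    rw [h3]
    exact h2

/-- Gives (a)ₙ / (a+1)ₙ = a / (a+n), the factor produced by integrating u^(a-1+n) over [0, 1]. -/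
theorem ascPochhammer_eval_add_one (a : ℝ) (n : ℕ) :
    a * (ascPochhammer ℝ n).eval (a + 1) = (ascPochhammer ℝ n).eval a * (a + n) := by
  have h := ascPochhammer_succ_left ℝ n
  rw [ascPochhammer_succ_right] at h
  simpa using (congrArg (Polynomial.eval a) h).symm

theorem integral_rpow_Ioc {a : ℝ} (ha : 0 < a) (d : ℕ) :
    ∫ u in Ioc (0 : ℝ) 1, u ^ (a - 1 + d) = 1 / (a + d) := by
  have hd : (0 : ℝ) ≤ d := Nat.cast_nonneg d
  have h : (0 : ℝ) < a + d := by linarith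
  rw [← intervalIntegral.integral_of_le zero_le_one, integral_rpow (Or.inl (by linarith)),
    one_rpow, zero_rpow (by linarith), sub_zero]
  ring_nf

/-- Termwise integration on `[0, 1]` of an absolutely convergent series against `u ^ (a - 1)`. -/
theorem hasSum_integral_rpow_mul_tsum {ι : Type*} [Countable ι] {a : ℝ} (ha : 0 < a) {K : ι → ℝ}
    (hK : Summable K) (d : ι → ℕ) :
    HasSum (fun i => K i * (1 / (a + d i)))
      (∫ u in (0 : ℝ)..1, u ^ (a - 1) * ∑' i, K i * u ^ d i) := by
  have hint (i : ι) : IntegrableOn (fun u : ℝ => K i * u ^ (a - 1 + d i)) (Ioc 0 1) := by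
    have hd : (0 : ℝ) ≤ d i := Nat.cast_nonneg _
    have h : IntervalIntegrable (fun u : ℝ => u ^ (a - 1 + d i)) volume 0 1 :=
      intervalIntegral.intervalIntegrable_rpow' (by linarith)
    exact ((intervalIntegrable_iff_integrableOn_Ioc_of_le zero_le_one).1 h).const_mul _
  have hnorm (i : ι) : ∫ u in Ioc (0 : ℝ) 1, ‖K i * u ^ (a - 1 + d i)‖ =
      ‖K i‖ * (1 / (a + d i)) := by
    rw [← integral_rpow_Ioc ha, ← integral_const_mul]
    refine setIntegral_congr_fun measurableSet_Ioc fun u hu => ?_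
    simp only [norm_mul]
    rw [Real.norm_of_nonneg (rpow_nonneg hu.1.le _)]
  -- The integrals of the norms are at most |K i| / a, uniformly in the exponent `d i`.
  have hsum : Summable fun i => ∫ u in Ioc (0 : ℝ) 1, ‖K i * u ^ (a - 1 + d i)‖ := by
    simp_rw [hnorm]
    have hK' : Summable fun i => ‖K i‖ := hK.norm
    refine Summable.of_nonneg_of_le (fun i => by positivity) (fun i => ?_)
      (hK'.mul_right (1 / a))
    have hd : (0 : ℝ) ≤ d i := Nat.cast_nonneg _
    gcongr
    linarith
  have key := hasSum_integral_of_summable_integral_norm hint hsum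
  simp only [integral_const_mul, integral_rpow_Ioc ha] at key
  rw [intervalIntegral.integral_of_le zero_le_one]
  have hS : ∫ u in Ioc (0 : ℝ) 1, u ^ (a - 1) * ∑' i, K i * u ^ d i =
      ∫ u in Ioc (0 : ℝ) 1, ∑' i, K i * u ^ (a - 1 + d i) := by
    refine setIntegral_congr_fun measurableSet_Ioc fun u hu => ?_
    simp only [← tsum_mul_left]
    refine tsum_congr fun i => ?_
    rw [rpow_add hu.1, rpow_natCast]
    ring
  rw [hS]
  exact key

/-- Expand each factor (1 - xᵢu)^(-bᵢ) in its binomial series, multiply, and integrate termwise. -/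
theorem lauricellaSeries_eq_integral {n : ℕ} {a : ℝ} (ha : 0 < a) (b x : Fin n → ℝ)
    (hx : ∀ i, |x i| < 1) :
    lauricellaSeries a b (a + 1) x =
      a * ∫ u in (0 : ℝ)..1, u ^ (a - 1) / ∏ i, (1 - x i * u) ^ b i := by
  have hK := hasSum_prod_fin fun i => hasSum_one_div_one_sub_rpow (b i) (hx i)
  have key := hasSum_integral_rpow_mul_tsum ha hK.summable fun m => ∑ i, m i
  have hF : ∫ u in (0 : ℝ)..1, u ^ (a - 1) / ∏ i, (1 - x i * u) ^ b i =
      ∫ u in (0 : ℝ)..1, u ^ (a - 1) * ∑' m : Fin n → ℕ,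
        (∏ i, (ascPochhammer ℝ (m i)).eval (b i) / ((m i).factorial : ℝ) * x i ^ m i) *
          u ^ ∑ i, m i := by
    rw [intervalIntegral.integral_of_le zero_le_one, intervalIntegral.integral_of_le zero_le_one]
    refine setIntegral_congr_fun measurableSet_Ioc fun u hu => ?_
    have h1 (i : Fin n) : |x i * u| < 1 := by
      rw [abs_mul, abs_of_pos hu.1]
      nlinarith [hx i, hu.2, hu.1, abs_nonneg (x i)]
    have h2 := hasSum_prod_fin fun i => hasSum_one_div_one_sub_rpow (b i) (h1 i)
    simp only [← Finset.prod_pow_eq_pow_sum, ← Finset.prod_mul_distrib, mul_assoc, ← mul_pow]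
    rw [h2.tsum_eq, Finset.prod_div_distrib]
    simp [div_eq_mul_inv]
  rw [hF, ← key.tsum_eq, ← tsum_mul_left]
  refine tsum_congr fun m => ?_
  have h1 := ascPochhammer_eval_add_one a (∑ i, m i)
  have h2 : 0 < (ascPochhammer ℝ (∑ i, m i)).eval (a + 1) := ascPochhammer_pos _ _ (by linarith)
  have h3 : (0 : ℝ) < a + (∑ i, m i : ℕ) := by positivity
  have h4 : (∏ i, ((m i).factorial : ℝ)) ≠ 0 :=
    Finset.prod_ne_zero_iff.2 fun i _ => by positivity
  simp only [Finset.prod_mul_distrib, Finset.prod_div_distrib]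
  generalize (∑ i, m i : ℕ) = N at h1 h2 h3 ⊢
  field_simp
  linear_combination -(∏ i, (ascPochhammer ℝ (m i)).eval (b i)) * (∏ i, x i ^ m i) * h1

/-- For third parameter a + 1 the factor (1 - u)^0 is 1 and the Gamma quotient is a, so both
branches of the definition take one form and no bound on `x` is needed. -/
theorem lauricellaFD_eq_integral {n : ℕ} {a : ℝ} (ha : 0 < a) (b x : Fin n → ℝ) :
    lauricellaFD a b (a + 1) x =
      a * ∫ u in (0 : ℝ)..1, u ^ (a - 1) / ∏ i, (1 - x i * u) ^ b i := by
  unfold lauricellaFD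
  split_ifs with h
  · exact lauricellaSeries_eq_integral ha b x h
  · have : Gamma a ≠ 0 := (Gamma_pos_of_pos ha).ne'
    simp only [lauricellaIntegral, add_sub_cancel_left, Gamma_one, mul_one, sub_self, rpow_zero,
      Gamma_add_one ha.ne']
    rw [mul_div_cancel_right₀ _ this]

/-! ### Integrals against the square root of the cubic -/

/-- The integrand is the nonnegative derivative of an arcsine that is continuous up to both ends. -/
theorem intervalIntegrable_one_div_sqrt_mul {a b : ℝ} (hab : a < b) :
    IntervalIntegrable (fun u => 1 / √((b - u) * (u - a))) volume a b := by
  rw [intervalIntegrable_iff_integrableOn_Ioc_of_le hab.le]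
  have hba : 0 < b - a := sub_pos.2 hab
  refine intervalIntegral.integrableOn_deriv_of_nonneg
    (g := fun u => arcsin ((2 * u - a - b) / (b - a))) ?_ (fun u hu => ?_) fun u _ => by positivity
  · exact (continuous_arcsin.comp (by fun_prop)).continuousOn
  · have h1 : 0 < u - a := sub_pos.2 hu.1
    have h2 : 0 < b - u := sub_pos.2 hu.2
    have hz1 : (2 * u - a - b) / (b - a) ≠ -1 := by
      rw [Ne, div_eq_iff hba.ne']
      intro h
      linarith
    have hz2 : (2 * u - a - b) / (b - a) ≠ 1 := by
      rw [Ne, div_eq_iff hba.ne']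
      intro h
      linarith
    have hin : HasDerivAt (fun u => (2 * u - a - b) / (b - a)) (2 / (b - a)) u := by
      simpa using ((((hasDerivAt_id u).const_mul 2).sub_const a).sub_const b).div_const (b - a)
    have h := (hasDerivAt_arcsin hz1 hz2).comp u hin
    have hs : √(1 - ((2 * u - a - b) / (b - a)) ^ 2) = 2 * √((b - u) * (u - a)) / (b - a) := by
      rw [sqrt_eq_iff_mul_self_eq_of_pos (by positivity)]
      have := mul_self_sqrt (mul_pos h2 h1).le
      field_simp
      linear_combination 4 * this
    refine HasDerivAt.congr_deriv h ?_
    rw [hs]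
    have : 0 < √((b - u) * (u - a)) := sqrt_pos.2 (mul_pos h2 h1)
    field_simp

theorem intervalIntegrable_div_sqrt_cubic {s₁ s₂ s₃ y : ℝ} (h₁ : -1 < s₁) (h₁₂ : s₁ < s₂)
    (h₂ : s₂ < 1) (h₃ : 1 < s₃) (hy : y ∈ Icc s₁ s₂) {q : ℝ → ℝ} (hq : Continuous q) :
    IntervalIntegrable (fun u => q u / ((1 - u ^ 2) * √((s₃ - u) * (s₂ - u) * (u - s₁))))
      volume s₁ y := by
  have hc : ContinuousOn (fun u => q u / ((1 - u ^ 2) * √(s₃ - u))) (uIcc s₁ s₂) := by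
    refine hq.continuousOn.div (by fun_prop) fun u hu => ?_
    rw [uIcc_of_le h₁₂.le] at hu
    have h4 : 0 < 1 - u ^ 2 := by nlinarith [hu.1, hu.2]
    have h5 : 0 < √(s₃ - u) := sqrt_pos.2 (by linarith [hu.2])
    positivity
  have h := (intervalIntegrable_one_div_sqrt_mul h₁₂).continuousOn_mul hc
  have h' : IntervalIntegrable (fun u => q u / ((1 - u ^ 2) * √((s₃ - u) * (s₂ - u) * (u - s₁))))
      volume s₁ s₂ := by
    refine h.congr fun u hu => ?_
    rw [uIoc_of_le h₁₂.le] at hu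
    rw [mul_assoc (s₃ - u), sqrt_mul (x := s₃ - u) (by linarith [hu.2]), ← mul_assoc,
      div_mul_div_comm, mul_one]
  refine h'.mono_set ?_
  rw [uIcc_of_le hy.1, uIcc_of_le h₁₂.le]
  exact Icc_subset_Icc le_rfl hy.2

/-- Under u = s₁ + (y - s₁)v each of 1 - u, 1 + u, s₃ - u, s₂ - u becomes its value at s₁ times 1 -
xᵢv, with xᵢ the entries of `spinArgs`. -/
theorem integral_pow_div_sqrt_cubic {s₁ s₂ s₃ y : ℝ} (h₁ : -1 < s₁) (h₁₂ : s₁ < s₂)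
    (h₂ : s₂ < 1) (h₃ : 1 < s₃) (hy : y ∈ Icc s₁ s₂) (n : ℕ) :
    ∫ u in s₁..y, (u - s₁) ^ n / ((1 - u ^ 2) * √((s₃ - u) * (s₂ - u) * (u - s₁))) =
      2 * √(y - s₁) / ((1 - s₁ ^ 2) * √((s₃ - s₁) * (s₂ - s₁))) *
        ((y - s₁) ^ n / (2 * n + 1) *
          lauricellaFD (n + 1 / 2) ![1, 1, 1 / 2, 1 / 2] (n + 1 / 2 + 1) (spinArgs s₁ s₂ s₃ y)) := by
  obtain ⟨d, rfl⟩ : ∃ d, y = s₁ + d := ⟨y - s₁, by ring⟩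
  have hd : 0 ≤ d := by linarith [hy.1]
  have hds : d ≤ s₂ - s₁ := by linarith [hy.2]
  rw [lauricellaFD_eq_integral (by positivity)]
  have hsub := intervalIntegral.smul_integral_comp_add_mul (a := 0) (b := 1)
    (fun u => (u - s₁) ^ n / ((1 - u ^ 2) * √((s₃ - u) * (s₂ - u) * (u - s₁)))) d s₁
  rw [mul_zero, add_zero, mul_one] at hsub
  rw [← hsub, smul_eq_mul, ← intervalIntegral.integral_const_mul]
  have hn : ((n : ℝ) + 1 / 2) = (2 * n + 1) / 2 := by ring
  have hn' : (2 * (n : ℝ) + 1) ≠ 0 := by positivity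
  have hre : ∀ I : ℝ, 2 * √(s₁ + d - s₁) / ((1 - s₁ ^ 2) * √((s₃ - s₁) * (s₂ - s₁))) *
        ((s₁ + d - s₁) ^ n / (2 * n + 1) * ((n + 1 / 2) * I)) =
      √d / ((1 - s₁ ^ 2) * √((s₃ - s₁) * (s₂ - s₁))) * d ^ n * I := by
    intro I
    rw [hn, add_sub_cancel_left]
    field_simp
  rw [hre, ← intervalIntegral.integral_const_mul, intervalIntegral.integral_of_le zero_le_one,
    intervalIntegral.integral_of_le zero_le_one]
  refine setIntegral_congr_fun measurableSet_Ioc fun v hv => ?_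
  have hv0 : 0 < v := hv.1
  have hdv : d * v ≤ d := mul_le_of_le_one_right hd hv.2
  have e1 : 1 - s₁ ≠ 0 := by linarith
  have e2 : 1 + s₁ ≠ 0 := by linarith
  have e3 : s₁ - s₃ ≠ 0 := by linarith
  have e4 : s₁ - s₂ ≠ 0 := by linarith
  simp only [spinArgs, Fin.prod_univ_four, Matrix.cons_val_zero, Matrix.cons_val_one,
    Matrix.cons_val, rpow_one, ← sqrt_eq_rpow, add_sub_cancel_left]
  have q3 : s₃ - (s₁ + d * v) = (s₃ - s₁) * (1 - -(d / (s₁ - s₃)) * v) := by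
    field_simp
    ring
  have q4 : s₂ - (s₁ + d * v) = (s₂ - s₁) * (1 - -(d / (s₁ - s₂)) * v) := by
    field_simp
    ring
  have q12 : 1 - (s₁ + d * v) ^ 2 =
      (1 - s₁ ^ 2) * ((1 - d / (1 - s₁) * v) * (1 - -(d / (1 + s₁)) * v)) := by
    field_simp
    ring
  have p3 : 0 ≤ 1 - -(d / (s₁ - s₃)) * v := by
    have : 0 ≤ (s₃ - s₁) * (1 - -(d / (s₁ - s₃)) * v) := by linarith
    exact nonneg_of_mul_nonneg_right this (by linarith)
  rw [q12, q3, q4]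
  have hT : (s₃ - s₁) * (1 - -(d / (s₁ - s₃)) * v) * ((s₂ - s₁) * (1 - -(d / (s₁ - s₂)) * v)) *
      (d * v) = ((s₃ - s₁) * (s₂ - s₁)) * ((1 - -(d / (s₁ - s₃)) * v) *
        ((1 - -(d / (s₁ - s₂)) * v) * (d * v))) := by ring
  have p4 : 0 ≤ 1 - -(d / (s₁ - s₂)) * v := by
    have : 0 ≤ (s₂ - s₁) * (1 - -(d / (s₁ - s₂)) * v) := by linarith
    exact nonneg_of_mul_nonneg_right this (by linarith)
  have pT : 0 ≤ (s₃ - s₁) * (s₂ - s₁) := mul_nonneg (by linarith) (by linarith)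
  rw [hT, sqrt_mul pT, sqrt_mul p3, sqrt_mul p4, sqrt_mul hd]
  have hvp : v ^ ((n : ℝ) + 1 / 2 - 1) = v ^ n * (√v)⁻¹ := by
    rw [show (n : ℝ) + 1 / 2 - 1 = n + -(1 / 2) by ring, rpow_add hv0, rpow_natCast,
      rpow_neg hv0.le, sqrt_eq_rpow]
  -- This also holds at d = 0, so the endpoint y = s₁ needs no separate case.
  have hsd : d * (√d)⁻¹ = √d := by rw [← div_eq_mul_inv, div_sqrt]
  rw [hvp]
  simp only [div_eq_mul_inv, mul_inv, mul_pow]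
  generalize (1 - -(d * (s₁ - s₃)⁻¹) * v) = X3
  generalize (1 - -(d * (s₁ - s₂)⁻¹) * v) = X4
  generalize (1 - -(d * (1 + s₁)⁻¹) * v) = X2
  generalize (1 - (d * (1 - s₁)⁻¹) * v) = X1
  linear_combination d ^ n * v ^ n * (1 - s₁ ^ 2)⁻¹ * X1⁻¹ * X2⁻¹ *
    (√((s₃ - s₁) * (s₂ - s₁)))⁻¹ * (√X3)⁻¹ * (√X4)⁻¹ * (√v)⁻¹ * hsd

/-- Integrals of a quadratic polynomial, written in powers of `u - s₁`, against the weight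
`1 / ((1 - u²) √((s₃ - u) (s₂ - u) (u - s₁)))`. -/
theorem integral_quadratic_div_sqrt_cubic {s₁ s₂ s₃ y : ℝ} (h₁ : -1 < s₁) (h₁₂ : s₁ < s₂)
    (h₂ : s₂ < 1) (h₃ : 1 < s₃) (hy : y ∈ Icc s₁ s₂) (a₀ a₁ a₂ : ℝ) :
    ∫ u in s₁..y, (a₀ + a₁ * (u - s₁) + a₂ * (u - s₁) ^ 2) /
        ((1 - u ^ 2) * √((s₃ - u) * (s₂ - u) * (u - s₁))) =
      2 * √(y - s₁) / ((1 - s₁ ^ 2) * √((s₃ - s₁) * (s₂ - s₁))) *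
        (a₀ * lauricellaXi s₁ s₂ s₃ y + a₁ / 3 * (y - s₁) * lauricellaLambda s₁ s₂ s₃ y
          + a₂ / 5 * (y - s₁) ^ 2 * lauricellaOmega s₁ s₂ s₃ y) := by
  have hi (n : ℕ) := intervalIntegrable_div_sqrt_cubic h₁ h₁₂ h₂ h₃ hy
    (q := fun u => (u - s₁) ^ n) (by fun_prop)
  have hm (n : ℕ) := integral_pow_div_sqrt_cubic h₁ h₁₂ h₂ h₃ hy n
  have hsplit : (fun u => (a₀ + a₁ * (u - s₁) + a₂ * (u - s₁) ^ 2) /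
        ((1 - u ^ 2) * √((s₃ - u) * (s₂ - u) * (u - s₁)))) = fun u =>
      a₀ * ((u - s₁) ^ 0 / ((1 - u ^ 2) * √((s₃ - u) * (s₂ - u) * (u - s₁)))) +
      a₁ * ((u - s₁) ^ 1 / ((1 - u ^ 2) * √((s₃ - u) * (s₂ - u) * (u - s₁)))) +
      a₂ * ((u - s₁) ^ 2 / ((1 - u ^ 2) * √((s₃ - u) * (s₂ - u) * (u - s₁)))) := by
    funext u
    ring
  rw [hsplit, intervalIntegral.integral_add
      (((hi 0).const_mul a₀).add ((hi 1).const_mul a₁)) ((hi 2).const_mul a₂),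
    intervalIntegral.integral_add ((hi 0).const_mul a₀) ((hi 1).const_mul a₁),
    intervalIntegral.integral_const_mul, intervalIntegral.integral_const_mul,
    intervalIntegral.integral_const_mul, hm 0, hm 1, hm 2]
  unfold lauricellaXi lauricellaLambda lauricellaOmega
  norm_num
  ring

/-! ### Kinematics and conservation laws of the symmetric top -/

section Mechanics

variable {A C M g zG : ℝ} {θ φ ψ p q r : ℝ → ℝ}

theorem IsHeavyBodyMotion.deriv_theta (hm : IsHeavyBodyMotion A A C M g 0 0 zG θ φ ψ p q r)
    (t : ℝ) : deriv θ t = p t * cos (φ t) - q t * sin (φ t) := by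
  rw [hm.p_eq, hm.q_eq]
  linear_combination -deriv θ t * sin_sq_add_cos_sq (φ t)

theorem IsHeavyBodyMotion.deriv_psi_mul_sin
    (hm : IsHeavyBodyMotion A A C M g 0 0 zG θ φ ψ p q r) (t : ℝ) :
    deriv ψ t * sin (θ t) = p t * sin (φ t) + q t * cos (φ t) := by
  rw [hm.p_eq, hm.q_eq]
  linear_combination -deriv ψ t * sin (θ t) * sin_sq_add_cos_sq (φ t)

theorem IsHeavyBodyMotion.r_eq_initial (hm : IsHeavyBodyMotion A A C M g 0 0 zG θ φ ψ p q r)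
    (hC : 0 < C) (t : ℝ) : r t = r 0 := by
  refine is_const_of_deriv_eq_zero hm.differentiable_r (fun x => ?_) t 0
  have h := hm.euler_r x
  simp only [sub_self, zero_mul, mul_zero] at h
  exact (mul_eq_zero.1 h).resolve_left hC.ne'

/-- This component equals θ', so its derivative is θ'', obtained from the differentiability of p, q
and φ without assuming θ twice differentiable. -/
theorem IsHeavyBodyMotion.hasDerivAt_nodal
    (hm : IsHeavyBodyMotion A A C M g 0 0 zG θ φ ψ p q r) (t : ℝ) :
    HasDerivAt (fun x => p x * cos (φ x) - q x * sin (φ x))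
      (deriv p t * cos (φ t) - deriv q t * sin (φ t)
        - deriv φ t * (p t * sin (φ t) + q t * cos (φ t))) t := by
  have hp := (hm.differentiable_p t).hasDerivAt
  have hq := (hm.differentiable_q t).hasDerivAt
  have hφ := (hm.differentiable_phi t).hasDerivAt
  exact ((hp.mul hφ.cos).sub (hq.mul hφ.sin)).congr_deriv (by ring)

theorem IsHeavyBodyMotion.hasDerivAt_transverse
    (hm : IsHeavyBodyMotion A A C M g 0 0 zG θ φ ψ p q r) (t : ℝ) :
    HasDerivAt (fun x => p x * sin (φ x) + q x * cos (φ x))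
      (deriv p t * sin (φ t) + deriv q t * cos (φ t)
        + deriv φ t * (p t * cos (φ t) - q t * sin (φ t))) t := by
  have hp := (hm.differentiable_p t).hasDerivAt
  have hq := (hm.differentiable_q t).hasDerivAt
  have hφ := (hm.differentiable_phi t).hasDerivAt
  exact ((hp.mul hφ.sin).add (hq.mul hφ.cos)).congr_deriv (by ring)

theorem IsHeavyBodyMotion.mul_deriv_nodal
    (hm : IsHeavyBodyMotion A A C M g 0 0 zG θ φ ψ p q r) (t : ℝ) :
    A * (deriv p t * cos (φ t) - deriv q t * sin (φ t)
        - deriv φ t * (p t * sin (φ t) + q t * cos (φ t))) =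
      (A - C) * r t * (p t * sin (φ t) + q t * cos (φ t)) + M * g * zG * sin (θ t)
        - A * deriv φ t * (p t * sin (φ t) + q t * cos (φ t)) := by
  linear_combination cos (φ t) * hm.euler_p t - sin (φ t) * hm.euler_q t
    + M * g * zG * sin (θ t) * sin_sq_add_cos_sq (φ t)

/-- The weight's torque lies along the line of nodes, so gravity drops out here. -/
theorem IsHeavyBodyMotion.mul_deriv_transverse
    (hm : IsHeavyBodyMotion A A C M g 0 0 zG θ φ ψ p q r) (t : ℝ) :
    A * (deriv p t * sin (φ t) + deriv q t * cos (φ t)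
        + deriv φ t * (p t * cos (φ t) - q t * sin (φ t))) =
      (C - A) * r t * (p t * cos (φ t) - q t * sin (φ t))
        + A * deriv φ t * (p t * cos (φ t) - q t * sin (φ t)) := by
  linear_combination sin (φ t) * hm.euler_p t + cos (φ t) * hm.euler_q t

/-- Conservation of the vertical component of the angular momentum. -/
theorem IsHeavyBodyMotion.verticalMomentum_eq_initial
    (hm : IsHeavyBodyMotion A A C M g 0 0 zG θ φ ψ p q r) (hC : 0 < C) (t : ℝ) :
    A * sin (θ t) * (p t * sin (φ t) + q t * cos (φ t)) + C * r 0 * cos (θ t) =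
      A * sin (θ 0) * (p 0 * sin (φ 0) + q 0 * cos (φ 0)) + C * r 0 * cos (θ 0) := by
  have hd (x : ℝ) : HasDerivAt (fun t => A * sin (θ t) * (p t * sin (φ t) + q t * cos (φ t))
      + C * r 0 * cos (θ t)) 0 x := by
    have hθ := (hm.differentiable_theta x).hasDerivAt
    refine (((hθ.sin.const_mul A).mul (hm.hasDerivAt_transverse x)).add
      (hθ.cos.const_mul (C * r 0))).congr_deriv ?_
    have hr := hm.r_eq_initial hC x
    rw [← hr]
    have h1 := hm.deriv_theta x
    have h2 := hm.deriv_psi_mul_sin x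
    have h3 := hm.mul_deriv_transverse x
    have h4 := hm.r_eq x
    rw [← h1] at h3 ⊢
    -- What is left is a multiple of φ' + ψ' cos θ - r.
    linear_combination sin (θ x) * h3 - A * cos (θ x) * deriv θ x * h2
      - A * sin (θ x) * deriv θ x * h4
  exact is_const_of_deriv_eq_zero (fun x => (hd x).differentiableAt) (fun x => (hd x).deriv) t 0

/-- Conservation of energy. -/
theorem IsHeavyBodyMotion.energy_eq_initial
    (hm : IsHeavyBodyMotion A A C M g 0 0 zG θ φ ψ p q r) (t : ℝ) :
    A * ((p t * cos (φ t) - q t * sin (φ t)) ^ 2 + (p t * sin (φ t) + q t * cos (φ t)) ^ 2)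
        + 2 * (M * g * zG) * cos (θ t) =
      A * ((p 0 * cos (φ 0) - q 0 * sin (φ 0)) ^ 2 + (p 0 * sin (φ 0) + q 0 * cos (φ 0)) ^ 2)
        + 2 * (M * g * zG) * cos (θ 0) := by
  have hd (x : ℝ) : HasDerivAt (fun t => A * ((p t * cos (φ t) - q t * sin (φ t)) ^ 2
      + (p t * sin (φ t) + q t * cos (φ t)) ^ 2) + 2 * (M * g * zG) * cos (θ t)) 0 x := by
    have hθ := (hm.differentiable_theta x).hasDerivAt
    refine (((((hm.hasDerivAt_nodal x).pow 2).add ((hm.hasDerivAt_transverse x).pow 2)).const_mul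
      A).add (hθ.cos.const_mul (2 * (M * g * zG)))).congr_deriv ?_
    rw [hm.deriv_theta x]
    push_cast
    -- The gyroscopic terms cancel between the two equations, and the work of gravity cancels the
    -- change of potential energy.
    linear_combination 2 * (p x * cos (φ x) - q x * sin (φ x)) * hm.mul_deriv_nodal x
      + 2 * (p x * sin (φ x) + q x * cos (φ x)) * hm.mul_deriv_transverse x
  exact is_const_of_deriv_eq_zero (fun x => (hd x).differentiableAt) (fun x => (hd x).deriv) t 0

/-- The equations of motion of `cos θ` and of the spin angle in terms of the reduced constants. -/
theorem IsHeavyBodyMotion.exists_deriv_cos_theta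
    (hm : IsHeavyBodyMotion A A C M g 0 0 zG θ φ ψ p q r) (hA : 0 < A) (hC : 0 < C)
    {ρ h c k lam : ℝ} (hρ : A * ρ ^ 2 = 2 * (M * g * zG)) (hc : C = c * A) (hr : r 0 = lam * ρ)
    (hK : A * p 0 * (sin (θ 0) * sin (φ 0)) + A * q 0 * (sin (θ 0) * cos (φ 0))
      + C * r 0 * cos (θ 0) = k * (A * ρ))
    (hE : 1 / 2 * (A * p 0 ^ 2 + A * q 0 ^ 2 + C * r 0 ^ 2) + M * g * (zG * cos (θ 0)) =
      h * (M * g * zG)) :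
    ∃ D : ℝ → ℝ, (∀ t, HasDerivAt (fun x => cos (θ x)) (D t) t) ∧
      (∀ t, D t ^ 2 = gyroResolvent ρ h c k lam (cos (θ t))) ∧
      (∀ t, HasDerivAt D (-cos (θ t) * (ρ ^ 2 * (h - c * lam ^ 2 - cos (θ t)))
        + c * ρ ^ 2 * lam * (k - c * lam * cos (θ t)) - ρ ^ 2 / 2 * (1 - cos (θ t) ^ 2)) t) ∧
      ∀ t, (1 - cos (θ t) ^ 2) * deriv φ t =
        ρ * (lam * (1 - cos (θ t) ^ 2) - (k - c * lam * cos (θ t)) * cos (θ t)) := by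
  have hA' := hA.ne'
  have hmom (t : ℝ) : sin (θ t) * (p t * sin (φ t) + q t * cos (φ t)) =
      ρ * (k - c * lam * cos (θ t)) := by
    have h1 := hm.verticalMomentum_eq_initial hC t
    refine mul_left_cancel₀ hA' ?_
    rw [hr, hc] at h1 hK
    linear_combination h1 + hK
  have hen (t : ℝ) : (p t * cos (φ t) - q t * sin (φ t)) ^ 2
      + (p t * sin (φ t) + q t * cos (φ t)) ^ 2 = ρ ^ 2 * (h - c * lam ^ 2 - cos (θ t)) := by
    have h1 := hm.energy_eq_initial t
    refine mul_left_cancel₀ hA' ?_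
    rw [hr, hc] at hE
    have h2 : A * ((p 0 * cos (φ 0) - q 0 * sin (φ 0)) ^ 2
        + (p 0 * sin (φ 0) + q 0 * cos (φ 0)) ^ 2) = A * (p 0 ^ 2 + q 0 ^ 2) := by
      linear_combination A * (p 0 ^ 2 + q 0 ^ 2) * sin_sq_add_cos_sq (φ 0)
    linear_combination h1 + h2 + 2 * hE - (h - cos (θ t)) * hρ
  have hS (t : ℝ) := sin_sq_add_cos_sq (θ t)
  refine ⟨fun t => -sin (θ t) * (p t * cos (φ t) - q t * sin (φ t)), fun t => ?_, fun t => ?_,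
    fun t => ?_, fun t => ?_⟩
  · simp only [← hm.deriv_theta t]
    exact (hm.differentiable_theta t).hasDerivAt.cos
  · unfold gyroResolvent
    -- With w = θ' and v = ψ' sin θ: D² = sin²θ (w² + v²) - (sin θ v)², where energy gives the first
    -- term and vertical momentum the second.
    linear_combination sin (θ t) ^ 2 * hen t
      + ρ ^ 2 * (h - c * lam ^ 2 - cos (θ t)) * hS t
      - (sin (θ t) * (p t * sin (φ t) + q t * cos (φ t))
        + ρ * (k - c * lam * cos (θ t))) * hmom t
  · have hθ := (hm.differentiable_theta t).hasDerivAt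
    refine (hθ.sin.neg.mul (hm.hasDerivAt_nodal t)).congr_deriv ?_
    have h1 := hm.mul_deriv_nodal t
    have h2 := hm.deriv_psi_mul_sin t
    have h3 := hm.r_eq t
    have h4 := hm.r_eq_initial hC t
    have h5 := hmom t
    have h6 := hen t
    have h7 := hS t
    rw [hm.deriv_theta t, Pi.neg_apply]
    generalize p t * cos (φ t) - q t * sin (φ t) = w at *
    generalize p t * sin (φ t) + q t * cos (φ t) = v at *
    generalize deriv p t * cos (φ t) - deriv q t * sin (φ t) - deriv φ t * v = w' at *
    have h8 : w' = -c * (lam * ρ) * v + ρ ^ 2 / 2 * sin (θ t)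
        + deriv ψ t * cos (θ t) * v := by
      refine mul_left_cancel₀ hA' ?_
      rw [hc] at h1
      rw [h4, hr] at h1 h3
      linear_combination h1 - sin (θ t) / 2 * hρ + A * v * h3
    rw [h8]
    linear_combination -cos (θ t) * h6 + c * lam * ρ * h5 - ρ ^ 2 / 2 * h7
      - cos (θ t) * v * h2
  · have h2 := hm.deriv_psi_mul_sin t
    have h3 := hm.r_eq t
    rw [hm.r_eq_initial hC t, hr] at h3
    linear_combination -sin (θ t) ^ 2 * h3 - (deriv φ t - ρ * lam) * hS t
      - cos (θ t) * sin (θ t) * h2 - cos (θ t) * hmom t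

end Mechanics

/-! ### One-dimensional motion between turning points -/

section Turning

variable {s₁ s₂ s₃ ρ : ℝ} {S D Φ : ℝ → ℝ} {t₀ t : ℝ}

/-- After a turning point at `s₁` a motion with `(S')² = ρ² (S - s₁)(S - s₂)(S - s₃)` and
positive acceleration at `s₁` is strictly increasing as long as it does not reach `s₂`. -/
theorem deriv_pos_of_turning_point (h₂₃ : s₂ < s₃) (hρ : 0 < ρ)
    (hS : ∀ x, HasDerivAt S (D x) x) (hmem : ∀ x, S x ∈ Icc s₁ s₂)
    (hD : ∀ x, D x ^ 2 = ρ ^ 2 * ((S x - s₁) * (S x - s₂) * (S x - s₃)))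
    (hDc : Continuous D) (hacc : ∀ x, S x = s₁ → ∃ a > 0, HasDerivAt D a x)
    (h0 : S t₀ = s₁) (hne : ∀ x ∈ Ioo t₀ t, S x ≠ s₂) :
    ∀ x ∈ Ioo t₀ t, 0 < D x := by
  have hz (x : ℝ) : S x = s₁ → D x = 0 := fun h => by
    have := hD x
    rw [h, sub_self, zero_mul, zero_mul, mul_zero] at this
    exact pow_eq_zero_iff two_ne_zero |>.1 this
  have hz' (x : ℝ) (h : D x = 0) : S x = s₁ ∨ S x = s₂ := by
    have h1 := hD x
    rw [h, zero_pow two_ne_zero, eq_comm] at h1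
    have h3 : S x - s₃ ≠ 0 := by linarith [(hmem x).2]
    have h4 := (mul_eq_zero.1 h1).resolve_left (by positivity)
    rcases mul_eq_zero.1 ((mul_eq_zero.1 h4).resolve_right h3) with h5 | h5
    · exact Or.inl (sub_eq_zero.1 h5)
    · exact Or.inr (sub_eq_zero.1 h5)
  -- D vanishes at t₀ with positive derivative, so it is positive at times arbitrarily soon after
  -- t₀.
  have hearly (b : ℝ) (hb : t₀ < b) : ∃ x ∈ Ioo t₀ b, 0 < D x := by
    obtain ⟨a, ha, hda⟩ := hacc t₀ h0
    have h1 := (hasDerivAt_iff_tendsto_slope.1 hda).eventually (eventually_gt_nhds ha)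
    have h2 := (h1.filter_mono (nhdsWithin_mono t₀ (t := {t₀}ᶜ) (s := Ioi t₀)
      fun x hx => ne_of_gt hx)).and (Ioo_mem_nhdsGT hb)
    obtain ⟨x, hx, hxm⟩ := h2.exists
    refine ⟨x, hxm, ?_⟩
    rw [slope_def_field, hz t₀ h0, sub_zero] at hx
    exact (div_pos_iff_of_pos_right (sub_pos.2 hxm.1)).1 hx
  -- A return to s₁ would produce an interior maximum above s₁; there D = 0, which forces the
  -- excluded value s₂.
  have hne₁ : ∀ x ∈ Ioo t₀ t, S x ≠ s₁ := by
    intro x hx hxs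
    obtain ⟨y, hy, hyD⟩ := hearly x hx.1
    have hyS : s₁ < S y := lt_of_le_of_ne (hmem y).1 fun h => hyD.ne' (hz y h.symm)
    have hcont : Continuous S := continuous_iff_continuousAt.2 fun u => (hS u).continuousAt
    obtain ⟨m, hm, hmax⟩ := isCompact_Icc.exists_isMaxOn (nonempty_Icc.2 hx.1.le)
      hcont.continuousOn
    have hmS : s₁ < S m := hyS.trans_le (hmax (Ioo_subset_Icc_self hy))
    have hm0 : m ≠ t₀ := by
      rintro rfl
      exact hmS.ne' h0
    have hmx : m ≠ x := by
      rintro rfl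
      exact hmS.ne' hxs
    have hm1 : t₀ < m := lt_of_le_of_ne hm.1 hm0.symm
    have hm2 : m < x := lt_of_le_of_ne hm.2 hmx
    have hloc : IsLocalMax S m := hmax.isLocalMax (Icc_mem_nhds hm1 hm2)
    rcases hz' m (hloc.hasDerivAt_eq_zero (hS m)) with h | h
    · exact hmS.ne' h
    · exact hne m ⟨hm1, hm2.trans hx.2⟩ h
  intro x hx
  by_contra hneg
  obtain ⟨y, hy, hyD⟩ := hearly t (hx.1.trans hx.2)
  obtain ⟨w, hw, hw0⟩ := isPreconnected_Ioo.intermediate_value hx hy hDc.continuousOn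
    (show (0 : ℝ) ∈ Icc (D x) (D y) from ⟨not_lt.1 hneg, hyD.le⟩)
  rcases hz' w hw0 with h | h
  · exact hne₁ w hw h
  · exact hne w hw h

variable {W : ℝ → ℝ}

/-- Quadrature along a rising branch. -/
theorem sub_eq_integral_of_rising (h₁₂ : s₁ < s₂) (h₂₃ : s₂ < s₃) (hρ : 0 < ρ)
    (hS : ∀ x, HasDerivAt S (D x) x) (hmem : ∀ x, S x ∈ Icc s₁ s₂)
    (hD : ∀ x, D x ^ 2 = ρ ^ 2 * ((S x - s₁) * (S x - s₂) * (S x - s₃)))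
    (hDc : Continuous D) (hacc : ∀ x, S x = s₁ → ∃ a > 0, HasDerivAt D a x)
    (hΦ : ∀ x, HasDerivAt Φ (ρ * W (S x)) x) (hW : ContinuousOn W (Icc s₁ s₂))
    (hint : IntervalIntegrable (fun u => W u / √((u - s₁) * (u - s₂) * (u - s₃))) volume s₁ s₂)
    (h0 : S t₀ = s₁) (ht : t₀ < t) (hne : ∀ x ∈ Ioo t₀ t, S x ≠ s₂) :
    Φ t - Φ t₀ = ∫ u in s₁..S t, W u / √((u - s₁) * (u - s₂) * (u - s₃)) := by
  have hpos := deriv_pos_of_turning_point h₂₃ hρ hS hmem hD hDc hacc h0 hne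
  have hcub (x : ℝ) (hx : x ∈ Ioo s₁ s₂) : 0 < (x - s₁) * (x - s₂) * (x - s₃) := by
    have := mul_pos (sub_pos.2 hx.1) (mul_pos (sub_pos.2 hx.2) (sub_pos.2 (hx.2.trans h₂₃)))
    linarith
  have hmem' (x : ℝ) (hx : x ∈ Ioo t₀ t) : S x ∈ Ioo s₁ s₂ := by
    refine ⟨lt_of_le_of_ne (hmem x).1 fun h => ?_, lt_of_le_of_ne (hmem x).2 (hne x hx)⟩
    have h1 := hD x
    rw [← h, sub_self, zero_mul, zero_mul, mul_zero] at h1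
    exact (pow_pos (hpos x hx) 2).ne' h1
  set G : ℝ → ℝ := fun s => ∫ u in s₁..s, W u / √((u - s₁) * (u - s₂) * (u - s₃))
  have hgc : ContinuousOn (fun u => W u / √((u - s₁) * (u - s₂) * (u - s₃))) (Ioo s₁ s₂) :=
    (hW.mono Ioo_subset_Icc_self).div (by fun_prop) fun u hu => (sqrt_pos.2 (hcub u hu)).ne'
  have hGc : ContinuousOn G (Icc s₁ s₂) := by
    have := intervalIntegral.continuousOn_primitive_interval' hint left_mem_uIcc
    rwa [uIcc_of_le h₁₂.le] at this
  have hGd (s : ℝ) (hs : s ∈ Ioo s₁ s₂) :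
      HasDerivAt G (W s / √((s - s₁) * (s - s₂) * (s - s₃))) s := by
    refine intervalIntegral.integral_hasDerivAt_right (hint.mono_set ?_)
      (hgc.stronglyMeasurableAtFilter isOpen_Ioo s hs) (hgc.continuousAt (isOpen_Ioo.mem_nhds hs))
    rw [uIcc_of_le hs.1.le, uIcc_of_le h₁₂.le]
    exact Icc_subset_Icc le_rfl hs.2.le
  have hSc : Continuous S := continuous_iff_continuousAt.2 fun u => (hS u).continuousAt
  have hΦc : Continuous Φ := continuous_iff_continuousAt.2 fun u => (hΦ u).continuousAt
  have hHc : ContinuousOn (fun x => Φ x - G (S x)) (Icc t₀ t) :=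
    hΦc.continuousOn.sub (hGc.comp hSc.continuousOn fun x _ => hmem x)
  have hHd (x : ℝ) (hx : x ∈ Ioo t₀ t) : HasDerivAt (fun x => Φ x - G (S x)) 0 x := by
    refine ((hΦ x).sub ((hGd (S x) (hmem' x hx)).comp x (hS x))).congr_deriv ?_
    have hr := sqrt_pos.2 (hcub _ (hmem' x hx))
    have hDx : D x = ρ * √((S x - s₁) * (S x - s₂) * (S x - s₃)) := by
      refine (pow_left_inj₀ (hpos x hx).le (by positivity) two_ne_zero).1 ?_
      rw [mul_pow, sq_sqrt (hcub _ (hmem' x hx)).le, hD]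
    rw [hDx]
    field_simp
    ring
  -- The integrand may blow up at s₁ and s₂, so the mean value theorem is applied with
  -- differentiability inside and only continuity at the ends.
  obtain ⟨w, _, hw⟩ := exists_hasDerivAt_eq_slope _ _ ht hHc hHd
  rw [eq_comm, div_eq_zero_iff] at hw
  have hG0 : G (S t₀) = 0 := by
    rw [h0]
    exact intervalIntegral.integral_same
  have := hw.resolve_right (sub_pos.2 ht).ne'
  rw [hG0] at this
  linarith

/-- Quadrature along a branch that starts from, or ends at, a turning point. -/
theorem sub_eq_sign_mul_integral (h₁₂ : s₁ < s₂) (h₂₃ : s₂ < s₃) (hρ : 0 < ρ)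
    (hS : ∀ x, HasDerivAt S (D x) x) (hmem : ∀ x, S x ∈ Icc s₁ s₂)
    (hD : ∀ x, D x ^ 2 = ρ ^ 2 * ((S x - s₁) * (S x - s₂) * (S x - s₃)))
    (hDc : Continuous D) (hacc : ∀ x, S x = s₁ → ∃ a > 0, HasDerivAt D a x)
    (hΦ : ∀ x, HasDerivAt Φ (ρ * W (S x)) x) (hW : ContinuousOn W (Icc s₁ s₂))
    (hint : IntervalIntegrable (fun u => W u / √((u - s₁) * (u - s₂) * (u - s₃))) volume s₁ s₂)
    (h0 : S t₀ = s₁) (hne : ∀ x ∈ uIoo t₀ t, S x ≠ s₂) :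
    Φ t - Φ t₀ = Real.sign (t - t₀) *
      ∫ u in s₁..S t, W u / √((u - s₁) * (u - s₂) * (u - s₃)) := by
  rcases lt_trichotomy t₀ t with h | rfl | h
  · rw [uIoo_of_lt h] at hne
    rw [Real.sign_of_pos (sub_pos.2 h), one_mul]
    exact sub_eq_integral_of_rising h₁₂ h₂₃ hρ hS hmem hD hDc hacc hΦ hW hint h0 h hne
  · simp
  · rw [uIoo_of_gt h] at hne
    rw [Real.sign_of_neg (sub_neg.2 h), neg_one_mul]
    -- Time reversal: S' and Φ change sign, while S'², S'' and Φ' keep theirs.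
    have key := sub_eq_integral_of_rising (S := fun x => S (-x)) (D := fun x => -D (-x))
      (Φ := fun x => -Φ (-x)) (t₀ := -t₀) (t := -t) h₁₂ h₂₃ hρ
      (fun x => ((hS (-x)).comp x (hasDerivAt_neg x)).congr_deriv (by ring))
      (fun x => hmem (-x)) (fun x => by rw [neg_sq, hD]) (hDc.comp continuous_neg).neg
      (fun x hx => by
        obtain ⟨a, ha, hd⟩ := hacc (-x) hx
        exact ⟨a, ha, ((hd.comp x (hasDerivAt_neg x)).neg).congr_deriv (by ring)⟩)
      (fun x => (((hΦ (-x)).comp x (hasDerivAt_neg x)).neg).congr_deriv (by ring))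
      hW hint (by simpa using h0) (neg_lt_neg h)
      (fun x hx => hne (-x) ⟨by linarith [hx.2], by linarith [hx.1]⟩)
    simp only [neg_neg] at key
    linarith

end Turning

/-! ### Roots of the resolvent and the spin quadrature -/

/-- The resolvent cubic has one root on each side of `x₀` in `(-1, 1)`, and a third one above `1`. -/
theorem gyroResolvent_exists_roots {ρ h c k lam x₀ : ℝ} (hρ : 0 < ρ) (hx₀ : x₀ ∈ Icc (-1) 1)
    (hne₁ : c * lam ≠ k) (hne₂ : c * lam ≠ -k) (hpos : 0 < gyroResolvent ρ h c k lam x₀) :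
    ∃ s₁ s₂ s₃ : ℝ, (-1 < s₁ ∧ s₁ < x₀ ∧ x₀ < s₂ ∧ s₂ < 1 ∧ 1 < s₃) ∧
      ∀ x, gyroResolvent ρ h c k lam x = ρ ^ 2 * ((x - s₁) * (x - s₂) * (x - s₃)) := by
  have hc : Continuous (gyroResolvent ρ h c k lam) := by
    unfold gyroResolvent
    fun_prop
  have hneg : gyroResolvent ρ h c k lam (-1) < 0 := by
    have h1 : k + c * lam ≠ 0 := fun h => hne₂ (by linarith)
    have h2 : 0 < ρ ^ 2 * (k + c * lam) ^ 2 := by positivity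
    unfold gyroResolvent
    linarith
  have hone : gyroResolvent ρ h c k lam 1 < 0 := by
    have h1 : k - c * lam ≠ 0 := fun h => hne₁ (by linarith)
    have h2 : 0 < ρ ^ 2 * (k - c * lam) ^ 2 := by positivity
    unfold gyroResolvent
    linarith
  obtain ⟨s₁, hs₁, hr₁⟩ := intermediate_value_Ioo hx₀.1 hc.continuousOn
    (show (0 : ℝ) ∈ Ioo _ _ from ⟨hneg, hpos⟩)
  obtain ⟨s₂, hs₂, hr₂⟩ := intermediate_value_Ioo' hx₀.2 hc.continuousOn
    (show (0 : ℝ) ∈ Ioo _ _ from ⟨hone, hpos⟩)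
  -- The third root comes from Vieta: the sum of the roots is h - cλ² + (cλ)². The two sides then
  -- differ by a polynomial of degree at most one vanishing at s₁ and s₂.
  have hfac (x : ℝ) : gyroResolvent ρ h c k lam x = ρ ^ 2 *
      ((x - s₁) * (x - s₂) * (x - (h - c * lam ^ 2 + (c * lam) ^ 2 - s₁ - s₂))) := by
    have hd : s₁ - s₂ ≠ 0 := by linarith [hs₁.2, hs₂.1]
    refine mul_left_cancel₀ hd ?_
    unfold gyroResolvent at hr₁ hr₂ ⊢
    linear_combination (x - s₂) * hr₁ - (x - s₁) * hr₂
  refine ⟨s₁, s₂, _, ⟨hs₁.1, hs₁.2, hs₂.1, hs₂.2, ?_⟩, hfac⟩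
  rw [hfac 1] at hone
  by_contra! hle
  have := mul_nonneg (mul_nonneg (sub_pos.2 (hs₁.2.trans_le hx₀.2)).le (sub_pos.2 hs₂.2).le)
    (sub_nonneg.2 hle)
  have := mul_nonneg (sq_nonneg ρ) this
  linarith

theorem spinIntegrand_eq (s₁ s₂ s₃ α u : ℝ) :
    spinIntegrand s₃ s₂ s₁ α u =
      (s₁ * (1 - α * s₁) + (1 - 2 * α * s₁) * (u - s₁) + -α * (u - s₁) ^ 2) /
        ((1 - u ^ 2) * √((s₃ - u) * (s₂ - u) * (u - s₁))) := by
  unfold spinIntegrand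
  rw [div_mul_div_comm]
  congr 1
  ring

/-- The numerator λ(1 - u²) - (k - cλu)u is Taylor expanded at s₁, where its coefficients become
those of Ξ, Λ and Ω. -/
theorem spin_rate_div_sqrt_eq {s₁ s₂ s₃ c k lam u : ℝ} (hu : 1 - u ^ 2 ≠ 0) :
    (lam - (k - c * lam * u) * u / (1 - u ^ 2)) / √((u - s₁) * (u - s₂) * (u - s₃)) =
      ((lam * (1 - s₁ ^ 2) - (k - c * lam * s₁) * s₁)
        + -(2 * lam * s₁ + k - 2 * c * lam * s₁) * (u - s₁) + -(lam - c * lam) * (u - s₁) ^ 2) /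
        ((1 - u ^ 2) * √((s₃ - u) * (s₂ - u) * (u - s₁))) := by
  rw [show (u - s₁) * (u - s₂) * (u - s₃) = (s₃ - u) * (s₂ - u) * (u - s₁) by ring, ← div_div]
  congr 1
  field_simp
  ring

theorem mem_Icc_of_cubic_nonneg {s₁ s₂ s₃ x : ℝ} (h₁₂ : s₁ < s₂) (h₃ : x < s₃)
    (h : 0 ≤ (x - s₁) * (x - s₂) * (x - s₃)) : x ∈ Icc s₁ s₂ := by
  have h4 := nonpos_of_mul_nonneg_left h (sub_neg.2 h₃)
  constructor <;> by_contra! h5 <;> nlinarith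

theorem one_sub_sq_ne_zero_of_mem_Icc {s₁ s₂ u : ℝ} (h₁ : -1 < s₁) (h₂ : s₂ < 1)
    (hu : u ∈ Icc s₁ s₂) : 1 - u ^ 2 ≠ 0 := by
  have : 0 < 1 - u ^ 2 := by nlinarith [hu.1, hu.2]
  exact this.ne'

theorem intervalIntegrable_spin_rate {s₁ s₂ s₃ : ℝ} (h₁ : -1 < s₁) (h₁₂ : s₁ < s₂)
    (h₂ : s₂ < 1) (h₃ : 1 < s₃) (c k lam : ℝ) :
    IntervalIntegrable (fun u => (lam - (k - c * lam * u) * u / (1 - u ^ 2)) /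
      √((u - s₁) * (u - s₂) * (u - s₃))) volume s₁ s₂ := by
  have h := intervalIntegrable_div_sqrt_cubic h₁ h₁₂ h₂ h₃ (right_mem_Icc.2 h₁₂.le)
    (q := fun u => (lam * (1 - s₁ ^ 2) - (k - c * lam * s₁) * s₁)
      + -(2 * lam * s₁ + k - 2 * c * lam * s₁) * (u - s₁) + -(lam - c * lam) * (u - s₁) ^ 2)
    (by fun_prop)
  refine h.congr fun u hu => ?_
  rw [uIoc_of_le h₁₂.le] at hu
  exact (spin_rate_div_sqrt_eq
    (one_sub_sq_ne_zero_of_mem_Icc h₁ h₂ (Ioc_subset_Icc_self hu))).symm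

theorem integral_spin_rate {s₁ s₂ s₃ y : ℝ} (h₁ : -1 < s₁) (h₁₂ : s₁ < s₂)
    (h₂ : s₂ < 1) (h₃ : 1 < s₃) (hy : y ∈ Icc s₁ s₂) (c k lam : ℝ) :
    ∫ u in s₁..y, (lam - (k - c * lam * u) * u / (1 - u ^ 2)) /
        √((u - s₁) * (u - s₂) * (u - s₃)) =
      2 * √(y - s₁) / ((1 - s₁ ^ 2) * √((s₃ - s₁) * (s₂ - s₁))) *
        ((lam * (1 - s₁ ^ 2) - (k - c * lam * s₁) * s₁) * lauricellaXi s₁ s₂ s₃ y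
          - (2 * lam * s₁ + k - 2 * c * lam * s₁) / 3 * (y - s₁) * lauricellaLambda s₁ s₂ s₃ y
          - (lam - c * lam) / 5 * (y - s₁) ^ 2 * lauricellaOmega s₁ s₂ s₃ y) := by
  have h := integral_quadratic_div_sqrt_cubic h₁ h₁₂ h₂ h₃ hy
    (lam * (1 - s₁ ^ 2) - (k - c * lam * s₁) * s₁) (-(2 * lam * s₁ + k - 2 * c * lam * s₁))
    (-(lam - c * lam))
  refine Eq.trans (intervalIntegral.integral_congr fun u hu => ?_) (h.trans (by ring))
  rw [uIcc_of_le hy.1] at hu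
  exact spin_rate_div_sqrt_eq (one_sub_sq_ne_zero_of_mem_Icc h₁ h₂ ⟨hu.1, hu.2.trans hy.2⟩)

/-- Half the derivative of the resolvent cubic is positive at its smallest root. -/
theorem gyroResolvent_half_deriv_pos {ρ h c k lam s₁ s₂ s₃ : ℝ} (hρ : 0 < ρ) (h₁₂ : s₁ < s₂)
    (h₁₃ : s₁ < s₃)
    (hfac : ∀ x, gyroResolvent ρ h c k lam x = ρ ^ 2 * ((x - s₁) * (x - s₂) * (x - s₃))) :
    0 < -s₁ * (ρ ^ 2 * (h - c * lam ^ 2 - s₁)) + c * ρ ^ 2 * lam * (k - c * lam * s₁)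
      - ρ ^ 2 / 2 * (1 - s₁ ^ 2) := by
  have h1 : 0 < ρ ^ 2 / 2 * ((s₂ - s₁) * (s₃ - s₁)) :=
    mul_pos (by positivity) (mul_pos (sub_pos.2 h₁₂) (sub_pos.2 h₁₃))
  refine h1.trans_eq ?_
  -- Values at 0 and ±1 suffice to compare the lower coefficients, as both cubics have leading
  -- coefficient ρ².
  have f0 := hfac 0
  have f1 := hfac 1
  have f2 := hfac (-1)
  unfold gyroResolvent at f0 f1 f2
  linear_combination -(s₁ / 2) * (f1 + f2 - 2 * f0) - (f1 - f2) / 4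

theorem mainTheorem2
    (A C M g zG : ℝ) (hA : 0 < A) (hC : 0 < C) (hM : 0 < M) (hg : 0 < g) (hzG : 0 < zG)
    (θ φ ψ p q r : ℝ → ℝ)
    (hmotion : IsHeavyBodyMotion A A C M g 0 0 zG θ φ ψ p q r)
    (r₀ K₀ E₀ : ℝ) (hr₀ : r₀ = r 0)
    (hK₀ : K₀ = A * p 0 * (sin (θ 0) * sin (φ 0)) + A * q 0 * (sin (θ 0) * cos (φ 0))
      + C * r 0 * cos (θ 0))
    (hE₀ : E₀ = 1 / 2 * (A * p 0 ^ 2 + A * q 0 ^ 2 + C * r 0 ^ 2) + M * g * (zG * cos (θ 0)))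
    (ρ h c k lam : ℝ) (hρ : ρ = √(2 * (M * g * zG / A))) (hh : h = E₀ / (M * g * zG))
    (hc : c = C / A) (hk : k = K₀ / (A * ρ)) (hlam : lam = r₀ / ρ)
    (hne₁ : c * lam ≠ k) (hne₂ : c * lam ≠ -k)
    (hpos : 0 < gyroResolvent ρ h c k lam (cos (θ 0))) :
    ∃ s₁ s₂ s₃ : ℝ,
      (-1 < s₁ ∧ s₁ < cos (θ 0) ∧ cos (θ 0) < s₂ ∧ s₂ < 1 ∧ 1 < s₃) ∧
      (∀ x : ℝ, gyroResolvent ρ h c k lam x = ρ ^ 2 * ((x - s₁) * (x - s₂) * (x - s₃))) ∧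
      (∀ α : ℝ, ∀ y ∈ Icc s₁ s₂,
        IntervalIntegrable (spinIntegrand s₃ s₂ s₁ α) volume s₁ y ∧
        spinIntegral s₃ s₂ s₁ α y =
          2 * √(y - s₁) / ((1 - s₁ ^ 2) * √((s₃ - s₁) * (s₂ - s₁))) *
            (s₁ * (1 - α * s₁) * lauricellaXi s₁ s₂ s₃ y
              + (1 - 2 * α * s₁) / 3 * (y - s₁) * lauricellaLambda s₁ s₂ s₃ y
              - α / 5 * (y - s₁) ^ 2 * lauricellaOmega s₁ s₂ s₃ y)) ∧
      (∀ t₀ t : ℝ, cos (θ t₀) = s₁ → (∀ τ ∈ uIoo t₀ t, cos (θ τ) ≠ s₂) →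
        φ t - φ t₀ = Real.sign (t - t₀) *
          (∫ u in s₁..cos (θ t), (lam - (k - c * lam * u) * u / (1 - u ^ 2)) /
            √((u - s₁) * (u - s₂) * (u - s₃))) ∧
        φ t - φ t₀ = Real.sign (t - t₀) *
          (2 * √(cos (θ t) - s₁) / ((1 - s₁ ^ 2) * √((s₃ - s₁) * (s₂ - s₁))) *
            ((lam * (1 - s₁ ^ 2) - (k - c * lam * s₁) * s₁) * lauricellaXi s₁ s₂ s₃ (cos (θ t))
              - (2 * lam * s₁ + k - 2 * c * lam * s₁) / 3 * (cos (θ t) - s₁)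
                * lauricellaLambda s₁ s₂ s₃ (cos (θ t))
              - (lam - c * lam) / 5 * (cos (θ t) - s₁) ^ 2
                * lauricellaOmega s₁ s₂ s₃ (cos (θ t))))) := by
  have hρ2 : 0 < 2 * (M * g * zG / A) := by positivity
  have hρ0 : 0 < ρ := hρ ▸ sqrt_pos.2 hρ2
  have hρsq : A * ρ ^ 2 = 2 * (M * g * zG) := by
    rw [hρ, sq_sqrt hρ2.le]
    field_simp
  have hcA : C = c * A := by
    rw [hc]
    field_simp
  have hr : r 0 = lam * ρ := by
    rw [hlam, hr₀]
    field_simp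
  have hK : A * p 0 * (sin (θ 0) * sin (φ 0)) + A * q 0 * (sin (θ 0) * cos (φ 0))
      + C * r 0 * cos (θ 0) = k * (A * ρ) := by
    rw [hk, ← hK₀]
    field_simp
  have hE : 1 / 2 * (A * p 0 ^ 2 + A * q 0 ^ 2 + C * r 0 ^ 2) + M * g * (zG * cos (θ 0)) =
      h * (M * g * zG) := by
    rw [hh, ← hE₀]
    field_simp
  obtain ⟨D, hS, hDsq, hDD, hφ⟩ := hmotion.exists_deriv_cos_theta hA hC hρsq hcA hr hK hE
  obtain ⟨s₁, s₂, s₃, ⟨hs₁, hs₁0, hs02, hs₂, hs₃⟩, hfac⟩ := gyroResolvent_exists_roots hρ0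
    ⟨neg_one_le_cos (θ 0), cos_le_one (θ 0)⟩ hne₁ hne₂ hpos
  have h₁₂ : s₁ < s₂ := hs₁0.trans hs02
  -- f(S) is the square D², hence nonnegative, and S ≤ 1 < s₃ excludes the range beyond the third
  -- root.
  have hmem (t : ℝ) : cos (θ t) ∈ Icc s₁ s₂ := by
    have h1 : 0 ≤ ρ ^ 2 * ((cos (θ t) - s₁) * (cos (θ t) - s₂) * (cos (θ t) - s₃)) := by
      rw [← hfac, ← hDsq]
      positivity
    exact mem_Icc_of_cubic_nonneg h₁₂ ((cos_le_one (θ t)).trans_lt hs₃)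
      (nonneg_of_mul_nonneg_right h1 (by positivity))
  have hone {u : ℝ} (hu : u ∈ Icc s₁ s₂) : 1 - u ^ 2 ≠ 0 :=
    one_sub_sq_ne_zero_of_mem_Icc hs₁ hs₂ hu
  have hacc (t : ℝ) (ht : cos (θ t) = s₁) : ∃ a > 0, HasDerivAt D a t := by
    refine ⟨_, ?_, hDD t⟩
    rw [ht]
    exact gyroResolvent_half_deriv_pos hρ0 h₁₂ (by linarith) hfac
  have hDc : Continuous D := continuous_iff_continuousAt.2 fun u => (hDD u).continuousAt
  have hΦ (x : ℝ) : HasDerivAt φ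
      (ρ * (fun u => lam - (k - c * lam * u) * u / (1 - u ^ 2)) (cos (θ x))) x := by
    refine (hmotion.differentiable_phi x).hasDerivAt.congr_deriv ?_
    have h1 := hone (hmem x)
    refine mul_left_cancel₀ h1 ?_
    rw [hφ]
    field_simp
  have hW : ContinuousOn (fun u => lam - (k - c * lam * u) * u / (1 - u ^ 2)) (Icc s₁ s₂) :=
    continuousOn_const.sub (ContinuousOn.div (by fun_prop) (by fun_prop) fun u hu => hone hu)
  have hint := intervalIntegrable_spin_rate hs₁ h₁₂ hs₂ hs₃ c k lam
  refine ⟨s₁, s₂, s₃, ⟨hs₁, hs₁0, hs02, hs₂, hs₃⟩, hfac, fun α y hy => ⟨?_, ?_⟩,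
    fun t₀ t ht₀ hne => ?_⟩
  · simp only [funext (spinIntegrand_eq s₁ s₂ s₃ α)]
    exact intervalIntegrable_div_sqrt_cubic hs₁ h₁₂ hs₂ hs₃ hy (by fun_prop)
  · unfold spinIntegral
    simp only [spinIntegrand_eq]
    rw [integral_quadratic_div_sqrt_cubic hs₁ h₁₂ hs₂ hs₃ hy]
    ring
  · have key := sub_eq_sign_mul_integral (S := fun x => cos (θ x)) h₁₂ (hs₂.trans hs₃) hρ0 hS hmem
      (fun x => by rw [hDsq, hfac]) hDc hacc hΦ hW hint ht₀ hne
    refine ⟨key, key.trans ?_⟩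
    rw [integral_spin_rate hs₁ h₁₂ hs₂ hs₃ (hmem t)]
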